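/- Work in $\mathbb{R}^n$ (and in $\mathbb{R}^n\times\mathbb{R}$) with the standard inner product. For a set $C$ put $C^*=\{v:\langle v,x\rangle\le 1\ \forall x\in C\}$ (for a cone $C$ this is the usual polar cone). For $x\in C$ let $\widehat N_C(x)=\{v:\langle v,y-x\rangle\le o(\|y-x\|)\text{ for }y\in C\}$; let $N_C$ be the mapping whose graph is the closure of the graph of $\widehat N_C$; let $\overline N_C(x)=\operatorname{cl}\operatorname{conv}N_C(x)$ be the Clarke normal cone, and let $\widehat T_C(x)=N_C(x)^*$ be the cone of regular tangents. For $f:\mathbb{R}^n\to\mathbb{R}\cup\{+\infty\}$ write $\operatorname{epi}f=\{(x,\mu)\in\mathbb{R}^n\times\mathbb{R}:f(x)\le\mu\}$, and for $f(x)$ finite write $\widehat\partial f(x)=\{v: f(z)\ge f(x)+\langle v,z-x\rangle+o(\|z-x\|)\}$ (with $\widehat\partial f(x)=\emptyset$ if $f(x)=+\infty$). Let $\partial f(x)$ be the set of all limits of sequences $v^k\in\widehat\partial f(x^k)$ with $x^k\to x$ (convergence $f(x^k)\to f(x)$ is not required). At a point $x$ where $f$ is finite, the Clarke horizon subdifferential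 is $\bar\partial^\infty f(x)=\{v:(v,0)\in\overline N_{\operatorname{epi}f}(x,f(x))\}$, and the regular subderivative $\hat df(x):\mathbb{R}^n\to\mathbb{R}\cup\{\pm\infty\}$ is the function with $\operatorname{epi}(\hat df(x))=\widehat T_{\operatorname{epi}f}(x,f(x))$; its domain is $\operatorname{dom}\hat df(x)=\{w:\hat df(x)(w)<+\infty\}$. **Lemma (continuity of $\hat df(\bar x)$).** Let $f:\mathbb{R}^n\to\mathbb{R}\cup\{+\infty\}$ be finite at $\bar x$ with $\partial f(\bar x)\neq\emptyset$. Then $$\operatorname{int}\big[(\bar\partial^\infty f(\bar x))^*\big]=\operatorname{int}\big[\operatorname{dom}\hat df(\bar x)\big],$$ and $\hat df(\bar x)$ is continuous (as an extended-real-valued function) on this set. -/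

import Mathlib

open Set Filter Topology

noncomputable section

namespace VarAnalysis

section Cones

variable {H : Type*} [NormedAddCommGroup H] [InnerProductSpace ℝ H]

/-- The polar `C* = {v | ⟨v, x⟩ ≤ 1 for all x ∈ C}`. -/
def polar (C : Set H) : Set H :=
  {v | ∀ x ∈ C, inner ℝ v x ≤ 1}

/-- The regular normal cone to `C` at `x`:
all `v` with `⟨v, y - x⟩ ≤ o(‖y - x‖)` for `y ∈ C`. -/
def regularNormalCone (C : Set H) (x : H) : Set H :=
  {v | ∀ ε : ℝ, 0 < ε → ∀ᶠ y in 𝓝[C] x, inner ℝ v (y - x) ≤ ε * ‖y - x‖}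

/-- The normal cone mapping: its graph is the closure of the graph of the
regular normal cone mapping (which is defined at the points of `C`). -/
def normalCone (C : Set H) (x : H) : Set H :=
  {v | (x, v) ∈ closure {p : H × H | p.1 ∈ C ∧ p.2 ∈ regularNormalCone C p.1}}

/-- The Clarke normal cone: the closed convex hull of the normal cone. -/
def clarkeNormalCone (C : Set H) (x : H) : Set H :=
  closure (convexHull ℝ (normalCone C x))

/-- The cone of regular tangents, the polar of the normal cone. -/
def regularTangentCone (C : Set H) (x : H) : Set H :=
  polar (normalCone C x)

end Cones

section Subdifferentials

variable {n : ℕ}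

/-- The epigraph, as a subset of the Euclidean space `ℝⁿ × ℝ`. -/
def epi (f : EuclideanSpace ℝ (Fin n) → EReal) :
    Set (WithLp 2 (EuclideanSpace ℝ (Fin n) × ℝ)) :=
  {p | f p.fst ≤ (p.snd : EReal)}

/-- The (effective) domain `{x | f x < ∞}`. -/
def dom (f : EuclideanSpace ℝ (Fin n) → EReal) : Set (EuclideanSpace ℝ (Fin n)) :=
  {x | f x < ⊤}

/-- The regular subdifferential: all `v` with
`f z ≥ f x + ⟨v, z - x⟩ + o(‖z - x‖)`; empty where `f` is not finite. -/
def regularSubdifferential (f : EuclideanSpace ℝ (Fin n) → EReal)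
    (x : EuclideanSpace ℝ (Fin n)) : Set (EuclideanSpace ℝ (Fin n)) :=
  {v | ∃ r : ℝ, f x = (r : EReal) ∧ ∀ ε : ℝ, 0 < ε → ∀ᶠ z in 𝓝 x,
    ((r + inner ℝ v (z - x) - ε * ‖z - x‖ : ℝ) : EReal) ≤ f z}

/-- The subdifferential: limits of regular subgradients at points `xₖ → x`. -/
def subdifferential (f : EuclideanSpace ℝ (Fin n) → EReal)
    (x : EuclideanSpace ℝ (Fin n)) : Set (EuclideanSpace ℝ (Fin n)) :=
  {v | ∃ xs vs : ℕ → EuclideanSpace ℝ (Fin n),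
    Tendsto xs atTop (𝓝 x) ∧ Tendsto vs atTop (𝓝 v) ∧
      ∀ k, vs k ∈ regularSubdifferential f (xs k)}

/-- The point `(x, f x)` of the graph, for `f x` finite. -/
def graphPoint (f : EuclideanSpace ℝ (Fin n) → EReal) (x : EuclideanSpace ℝ (Fin n)) :
    WithLp 2 (EuclideanSpace ℝ (Fin n) × ℝ) :=
  WithLp.toLp 2 (x, (f x).toReal)

/-- The Clarke horizon subdifferential:
all `v` with `(v, 0)` in the Clarke normal cone to the epigraph at `(x, f x)`. -/
def clarkeHorizonSubdifferential (f : EuclideanSpace ℝ (Fin n) → EReal)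
    (x : EuclideanSpace ℝ (Fin n)) : Set (EuclideanSpace ℝ (Fin n)) :=
  {v | WithLp.toLp 2 (v, (0 : ℝ)) ∈ clarkeNormalCone (epi f) (graphPoint f x)}

/-- The regular subderivative, the extended-real-valued function on `ℝⁿ` whose epigraph is
the cone of regular tangents to `epi f` at `(x, f x)`; see `epi_regularSubderivative`. -/
def regularSubderivative (f : EuclideanSpace ℝ (Fin n) → EReal)
    (x : EuclideanSpace ℝ (Fin n)) : EuclideanSpace ℝ (Fin n) → EReal :=
  fun w => sInf {b : EReal | ∃ β : ℝ, b = (β : EReal) ∧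
    WithLp.toLp 2 (w, β) ∈ regularTangentCone (epi f) (graphPoint f x)}

theorem snd_nonpos_of_mem_regularNormalCone_epi {f : EuclideanSpace ℝ (Fin n) → EReal}
    {p v : WithLp 2 (EuclideanSpace ℝ (Fin n) × ℝ)} (hp : p ∈ epi f)
    (hv : v ∈ regularNormalCone (epi f) p) : v.snd ≤ 0 := by
  refine le_of_forall_pos_le_add fun ε hε => ?_
  let g : ℝ → WithLp 2 (EuclideanSpace ℝ (Fin n) × ℝ) :=
    fun t => p + t • WithLp.toLp 2 (0, 1)
  have hg : Tendsto g (𝓝[>] 0) (𝓝[epi f] p) := by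
    refine tendsto_nhdsWithin_iff.2 ⟨?_, ?_⟩
    · have hc : Continuous g := by fun_prop
      have h0 : g 0 = p := by simp [g]
      exact (h0 ▸ hc.tendsto 0).mono_left nhdsWithin_le_nhds
    · filter_upwards [self_mem_nhdsWithin] with t ht
      have ht' : (0 : ℝ) < t := ht
      have h1 : f p.fst ≤ (p.snd : EReal) := hp
      have h2 : (p.snd : EReal) ≤ ((p.snd + t : ℝ) : EReal) := by
        exact_mod_cast (by linarith : p.snd ≤ p.snd + t)
      simpa [g, epi] using h1.trans h2
  obtain ⟨t, ht, ht0⟩ := ((hg.eventually (hv ε hε)).and self_mem_nhdsWithin).exists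
  have ht' : (0 : ℝ) < t := ht0
  have hn : ‖(WithLp.toLp 2 (0, 1) : WithLp 2 (EuclideanSpace ℝ (Fin n) × ℝ))‖ = 1 := by
    simp
  have : t * v.snd ≤ ε * t := by
    simpa [g, norm_smul, hn, abs_of_pos ht', inner_smul_right, WithLp.prod_inner_apply] using ht
  nlinarith

theorem snd_nonpos_of_mem_normalCone_epi {f : EuclideanSpace ℝ (Fin n) → EReal}
    {p v : WithLp 2 (EuclideanSpace ℝ (Fin n) × ℝ)}
    (hv : v ∈ normalCone (epi f) p) : v.snd ≤ 0 := by
  have hc : IsClosed {q : WithLp 2 (EuclideanSpace ℝ (Fin n) × ℝ) ×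
      WithLp 2 (EuclideanSpace ℝ (Fin n) × ℝ) | q.2.snd ≤ 0} :=
    isClosed_le (by fun_prop) continuous_const
  exact closure_minimal
    (fun q hq => snd_nonpos_of_mem_regularNormalCone_epi hq.1 hq.2) hc hv

/-- The defining relation of the regular subderivative. -/
theorem epi_regularSubderivative (f : EuclideanSpace ℝ (Fin n) → EReal)
    (x : EuclideanSpace ℝ (Fin n)) :
    epi (regularSubderivative f x) = regularTangentCone (epi f) (graphPoint f x) := by
  ext p
  constructor
  · intro hp v hv
    have hp' : regularSubderivative f x p.fst ≤ (p.snd : EReal) := hp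
    have hv0 := snd_nonpos_of_mem_normalCone_epi hv
    refine le_of_forall_pos_le_add fun ε hε => ?_
    have hpos : 0 < ε / (1 - v.snd) := div_pos hε (by linarith)
    have hlt : regularSubderivative f x p.fst < ((p.snd + ε / (1 - v.snd) : ℝ) : EReal) :=
      hp'.trans_lt (by exact_mod_cast (by linarith : p.snd < p.snd + ε / (1 - v.snd)))
    obtain ⟨b, ⟨β, rfl, hβ⟩, hb⟩ := sInf_lt_iff.1 hlt
    have hb' : β < p.snd + ε / (1 - v.snd) := by exact_mod_cast hb
    have h1 := hβ v hv
    simp only [WithLp.prod_inner_apply] at h1 ⊢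
    have h2 : inner ℝ p.fst v.fst + v.snd * β ≤ 1 := by simpa [mul_comm] using h1
    have h3 : ε / (1 - v.snd) * (1 - v.snd) = ε := div_mul_cancel₀ _ (by linarith)
    have h4 : inner ℝ p.fst v.fst + v.snd * p.snd ≤ 1 + ε := by nlinarith
    simpa [mul_comm] using h4
  · intro hp
    show regularSubderivative f x p.fst ≤ (p.snd : EReal)
    have hmem : ∃ β : ℝ, (p.snd : EReal) = (β : EReal) ∧
        WithLp.toLp 2 (p.fst, β) ∈ regularTangentCone (epi f) (graphPoint f x) :=
      ⟨p.snd, rfl, hp⟩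
    exact sInf_le hmem

end Subdifferentials

end VarAnalysis

end

/-! Let `T` be the regular tangent cone to `epi f` at the graph point: a polar, hence convex, and
the epigraph of the regular subderivative. Its projection to `ℝⁿ` is the domain `D`. By the bipolar
theorem the polar of `T` is the Clarke normal cone, and the polar of a projection is the slice at
height `0`, so the polar of `D` is the Clarke horizon subdifferential. Polarizing again places the
polar of the latter between `D` and `closure D`; as `D` is convex in finite dimension, all three
have the same interior.

Continuity is that of a convex function on an open set: either the value `⊥` occurs and spreads over
the interior of `D`, or the function is real-valued there. -/

namespace VarAnalysis

/-- In finite dimension a convex set has the same interior as its closure. -/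
theorem interior_closure_of_convex {E : Type*} [NormedAddCommGroup E] [NormedSpace ℝ E]
    [FiniteDimensional ℝ E] {D : Set E} (hD : Convex ℝ D) :
    interior (closure D) = interior D := by
  rcases (interior (closure D)).eq_empty_or_nonempty with h | h
  · rw [h]
    exact (subset_empty_iff.1 (h ▸ interior_mono subset_closure)).symm
  · refine hD.interior_closure_eq_interior_of_nonempty_interior ?_
    rw [hD.interior_nonempty_iff_affineSpan_eq_top]
    rw [hD.closure.interior_nonempty_iff_affineSpan_eq_top] at h
    rw [eq_top_iff, ← h]
    -- Affine subspaces are closed, so `D` and `closure D` have the same affine span.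
    exact affineSpan_le.2
      (closure_minimal (subset_affineSpan ℝ D) (affineSpan ℝ D).closed_of_finiteDimensional)

section Polar

variable {H : Type*} [NormedAddCommGroup H] [InnerProductSpace ℝ H]

theorem convex_polar (C : Set H) : Convex ℝ (polar C) := by
  intro u hu v hv a b ha hb hab z hz
  have h1 := hu z hz
  have h2 := hv z hz
  rw [inner_add_left, real_inner_smul_left, real_inner_smul_left]
  nlinarith

theorem zero_mem_polar (C : Set H) : (0 : H) ∈ polar C := fun z _ => by simp

/-- A point outside a closed convex set containing the origin is cut off by a polar vector. -/
theorem exists_mem_polar_one_lt_inner [CompleteSpace H] {C : Set H} (hC : Convex ℝ C)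
    (h0 : (0 : H) ∈ C) {w : H} (hw : w ∉ closure C) :
    ∃ v ∈ polar C, 1 < inner ℝ v w := by
  obtain ⟨l, u, hl, hu⟩ := geometric_hahn_banach_closed_point hC.closure isClosed_closure hw
  -- Since `0 ∈ C`, the separating level is positive and `l` can be rescaled to level `1`.
  have hu0 : 0 < u := by simpa using hl 0 (subset_closure h0)
  have key : ∀ z, inner ℝ (u⁻¹ • (InnerProductSpace.toDual ℝ H).symm l) z = u⁻¹ * l z := by
    intro z
    rw [real_inner_smul_left, InnerProductSpace.toDual_symm_apply]
  refine ⟨u⁻¹ • (InnerProductSpace.toDual ℝ H).symm l, fun z hz => ?_, ?_⟩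
  · rw [key, inv_mul_le_one₀ hu0]
    exact (hl z (subset_closure hz)).le
  · rw [key, one_lt_inv_mul₀ hu0]
    exact hu

theorem inner_le_one_of_mem_closure_convexHull {C : Set H} {t v : H} (ht : t ∈ polar C)
    (hv : v ∈ closure (convexHull ℝ C)) : inner ℝ t v ≤ 1 := by
  have hc : IsClosed {z : H | inner ℝ t z ≤ 1} := isClosed_le (by fun_prop) continuous_const
  have hconv : Convex ℝ {z : H | inner ℝ t z ≤ 1} :=
    convex_halfSpace_le (innerₗ H t).isLinear 1
  exact closure_minimal (convexHull_min (fun z hz => ht z hz) hconv) hc hv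

theorem zero_mem_normalCone {C : Set H} {x : H} (hx : x ∈ C) : (0 : H) ∈ normalCone C x := by
  refine subset_closure ⟨hx, fun ε hε => Eventually.of_forall fun y => ?_⟩
  simpa using by positivity

end Polar

section Subderivative

variable {n : ℕ} {f : EuclideanSpace ℝ (Fin n) → EReal} {x : EuclideanSpace ℝ (Fin n)}

/-- Real upper bounds are points of the tangent cone, so convexity can be used without arithmetic in
`EReal`. -/
theorem regularSubderivative_le_coe_iff {w : EuclideanSpace ℝ (Fin n)} {β : ℝ} :
    regularSubderivative f x w ≤ (β : EReal) ↔
      WithLp.toLp 2 (w, β) ∈ regularTangentCone (epi f) (graphPoint f x) := by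
  rw [← epi_regularSubderivative]
  rfl

theorem mem_dom_regularSubderivative_iff {w : EuclideanSpace ℝ (Fin n)} :
    w ∈ dom (regularSubderivative f x) ↔ ∃ β : ℝ, regularSubderivative f x w ≤ (β : EReal) := by
  constructor
  · intro hw
    obtain ⟨β, hβ, -⟩ := EReal.lt_iff_exists_real_btwn.1 hw
    exact ⟨β, hβ.le⟩
  · rintro ⟨β, hβ⟩
    exact hβ.trans_lt (EReal.coe_lt_top β)

/-- Convexity of the regular subderivative, in terms of real upper bounds. -/
theorem regularSubderivative_combo_le {w z : EuclideanSpace ℝ (Fin n)} {β γ a b : ℝ}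
    (hw : regularSubderivative f x w ≤ (β : EReal))
    (hz : regularSubderivative f x z ≤ (γ : EReal))
    (ha : 0 ≤ a) (hb : 0 ≤ b) (hab : a + b = 1) :
    regularSubderivative f x (a • w + b • z) ≤ ((a * β + b * γ : ℝ) : EReal) := by
  rw [regularSubderivative_le_coe_iff] at *
  exact convex_polar _ hw hz ha hb hab

theorem convex_dom_regularSubderivative : Convex ℝ (dom (regularSubderivative f x)) := by
  intro w hw z hz a b ha hb hab
  rw [mem_dom_regularSubderivative_iff] at *
  obtain ⟨β, hβ⟩ := hw
  obtain ⟨γ, hγ⟩ := hz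
  exact ⟨_, regularSubderivative_combo_le hβ hγ ha hb hab⟩

theorem zero_mem_dom_regularSubderivative :
    (0 : EuclideanSpace ℝ (Fin n)) ∈ dom (regularSubderivative f x) :=
  mem_dom_regularSubderivative_iff.2 ⟨0, regularSubderivative_le_coe_iff.2 (zero_mem_polar _)⟩

theorem graphPoint_mem_epi (hx : f x ≠ ⊤) : graphPoint f x ∈ epi f :=
  EReal.le_coe_toReal hx

/-- Pairing a tangent `(w, β)` with `(v, 0)` leaves only `inner ℝ w v`, whatever `β` is. -/
theorem dom_regularSubderivative_subset_polar :
    dom (regularSubderivative f x) ⊆ polar (clarkeHorizonSubdifferential f x) := by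
  intro w hw v hv
  obtain ⟨β, hβ⟩ := mem_dom_regularSubderivative_iff.1 hw
  simpa [WithLp.prod_inner_apply] using
    inner_le_one_of_mem_closure_convexHull (regularSubderivative_le_coe_iff.1 hβ) hv

/-- If `(v, 0)` is not a Clarke normal, separation gives a tangent whose projection lies in the
domain and pairs with `v` to more than `1`. -/
theorem polar_dom_regularSubderivative_subset (hx : f x ≠ ⊤) :
    polar (dom (regularSubderivative f x)) ⊆ clarkeHorizonSubdifferential f x := by
  intro v hv
  by_contra hnot
  have h0 : (0 : WithLp 2 (EuclideanSpace ℝ (Fin n) × ℝ)) ∈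
      convexHull ℝ (normalCone (epi f) (graphPoint f x)) :=
    subset_convexHull ℝ _ (zero_mem_normalCone (graphPoint_mem_epi hx))
  obtain ⟨p, hp, hlt⟩ := exists_mem_polar_one_lt_inner (convex_convexHull ℝ _) h0 hnot
  have hpT : regularSubderivative f x p.fst ≤ (p.snd : EReal) :=
    regularSubderivative_le_coe_iff.2 fun z hz => hp z (subset_convexHull ℝ _ hz)
  have h1 : inner ℝ v p.fst ≤ 1 := hv _ (mem_dom_regularSubderivative_iff.2 ⟨_, hpT⟩)
  rw [real_inner_comm] at h1
  have h2 : 1 < inner ℝ p.fst v := by simpa [WithLp.prod_inner_apply] using hlt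
  linarith

theorem polar_subset_closure_dom_regularSubderivative (hx : f x ≠ ⊤) :
    polar (clarkeHorizonSubdifferential f x) ⊆ closure (dom (regularSubderivative f x)) := by
  intro w hw
  by_contra hnot
  obtain ⟨v, hv, hlt⟩ := exists_mem_polar_one_lt_inner convex_dom_regularSubderivative
    zero_mem_dom_regularSubderivative hnot
  have h := hw v (polar_dom_regularSubderivative_subset hx hv)
  rw [real_inner_comm] at h
  linarith

theorem interior_polar_clarkeHorizonSubdifferential (hx : f x ≠ ⊤) :
    interior (polar (clarkeHorizonSubdifferential f x)) =
      interior (dom (regularSubderivative f x)) :=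
  Subset.antisymm
    ((interior_mono (polar_subset_closure_dom_regularSubderivative hx)).trans
      (interior_closure_of_convex convex_dom_regularSubderivative).subset)
    (interior_mono dom_regularSubderivative_subset_polar)

/-- If the regular subderivative takes the value `-∞` anywhere, it is identically `-∞` on the
interior of its domain. -/
theorem regularSubderivative_eq_bot_of_mem_interior {w z : EuclideanSpace ℝ (Fin n)}
    (hw : regularSubderivative f x w = ⊥)
    (hz : z ∈ interior (dom (regularSubderivative f x))) :
    regularSubderivative f x z = ⊥ := by
  -- Prolonging the segment from `w` slightly past `z` stays in the domain, so `z` is a convex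
  -- combination with positive weight on `w`.
  have hc : Tendsto (fun t : ℝ => z + t • (z - w)) (𝓝[>] 0) (𝓝 z) := by
    have hcont : Continuous fun t : ℝ => z + t • (z - w) := by fun_prop
    simpa using (hcont.tendsto 0).mono_left nhdsWithin_le_nhds
  obtain ⟨t, htD, ht⟩ :=
    ((hc.eventually (mem_interior_iff_mem_nhds.1 hz)).and self_mem_nhdsWithin).exists
  have ht : (0 : ℝ) < t := ht
  obtain ⟨β, hβ⟩ := mem_dom_regularSubderivative_iff.1 htD
  have h1t : (1 + t) ≠ 0 := by positivity
  have hzeq : (1 + t)⁻¹ • (z + t • (z - w)) + (t / (1 + t)) • w = z := by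
    match_scalars <;> field_simp
    ring
  rw [EReal.eq_bot_iff_forall_lt]
  intro y
  -- Any real bounds the value at `w`; this `γ` makes the combined bound equal `y - 1`.
  have hle := regularSubderivative_combo_le (a := (1 + t)⁻¹) (b := t / (1 + t))
    (γ := ((y - 1) * (1 + t) - β) / t) hβ (hw ▸ bot_le)
    (by positivity) (by positivity) (by field_simp)
  rw [hzeq] at hle
  refine hle.trans_lt (EReal.coe_lt_coe_iff.2 ?_)
  have : (1 + t)⁻¹ * β + t / (1 + t) * (((y - 1) * (1 + t) - β) / t) = y - 1 := by
    field_simp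
    ring
  linarith

theorem continuousOn_regularSubderivative :
    ContinuousOn (regularSubderivative f x) (interior (dom (regularSubderivative f x))) := by
  by_cases h : ∃ w, regularSubderivative f x w = ⊥
  · obtain ⟨w, hw⟩ := h
    exact continuousOn_const.congr fun z hz => regularSubderivative_eq_bot_of_mem_interior hw hz
  · push Not at h
    have hcoe : ∀ z ∈ interior (dom (regularSubderivative f x)),
        ((regularSubderivative f x z).toReal : EReal) = regularSubderivative f x z :=
      fun z hz => EReal.coe_toReal (interior_subset hz).ne (h z)
    -- With `⊥` excluded, the real-valued version is convex on an open set in finite dimension,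
    -- hence continuous.
    have hconv : ConvexOn ℝ (interior (dom (regularSubderivative f x)))
        fun z => (regularSubderivative f x z).toReal := by
      refine ⟨convex_dom_regularSubderivative.interior, fun w hw z hz a b ha hb hab => ?_⟩
      have hle := regularSubderivative_combo_le (hcoe w hw).ge (hcoe z hz).ge ha hb hab
      rw [← hcoe _ (convex_dom_regularSubderivative.interior hw hz ha hb hab)] at hle
      simpa using EReal.coe_le_coe_iff.1 hle
    exact (continuous_coe_real_ereal.comp_continuousOn
      (hconv.continuousOn isOpen_interior)).congr fun z hz => (hcoe z hz).symm

end Subderivative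

end VarAnalysis

theorem mainTheorem11 (n : ℕ) (f : EuclideanSpace ℝ (Fin n) → EReal)
    (hf : ∀ z, f z ≠ ⊥) (x : EuclideanSpace ℝ (Fin n)) (hx : f x ≠ ⊤)
    (hsub : (VarAnalysis.subdifferential f x).Nonempty) :
    interior (VarAnalysis.polar (VarAnalysis.clarkeHorizonSubdifferential f x)) =
        interior (VarAnalysis.dom (VarAnalysis.regularSubderivative f x)) ∧
      ContinuousOn (VarAnalysis.regularSubderivative f x)
        (interior (VarAnalysis.polar (VarAnalysis.clarkeHorizonSubdifferential f x))) := by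
  rw [VarAnalysis.interior_polar_clarkeHorizonSubdifferential hx]
  exact ⟨rfl, VarAnalysis.continuousOn_regularSubderivative⟩
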